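/- Fix $\varepsilon\in(0,\frac12)$. Let $D_0$ be the graph with two vertices joined by an edge; $D_n$ is obtained from $D_{n-1}$ by replacing each edge $uv$ of $D_{n-1}$ by a quadrilateral $u,a,v,b$ with edges $ua,av,vb,bu$, where $a,b$ are two new vertices. The weighted diamonds are the weighted graphs $W_0=D_0$, whose only edge has weight $1$, and $W_n=D_n\cup W_{n-1}$ for $n\ge1$, where the edges of $D_n$ have weight $(\frac12+\varepsilon)^n$ and the edges of $W_{n-1}$ keep their weights. The vertex set of $W_n$ carries the shortest path distance $d_{W_n}$, and $|W_n|$ denotes the number of vertices of $W_n$. The distortion of an injective map $f:W_n\to X$ into a Banach space $X$ is $$\sup_{u\ne v}\frac{\|f(u)-f(v)\|}{d_{W_n}(u,v)}\cdot\sup_{u\ne v}\frac{d_{W_n}(u,v)}{\|f(u)-f(v)\|},$$ and $W_n$ $D$-embeds into $X$ if there is an injective map $f:W_n\to X$ of distortion at most $D$. The basis constant of a (finite or infinite) Schauder basis $x_0,x_1,\dots$ of $X$ is $\sup_j\|P_j\|$, where $P_j\left(\sum_i a_ix_i\right)=\sum_{i\le j}a_ix_i$. **Theorem.** For every $C\ge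 1$ and $\varepsilon\in(0,\frac12)$ there exists a constant $D\ge1$ such that for every $n\ge2$, $W_n$ $D$-embeds into every real or complex Banach space $X$ of (finite or infinite) dimension $\dim X\ge\frac12(\log_2|W_n|)^2$ that has a Schauder basis with basis constant at most $C$. -/

import Mathlib

open scoped ENNReal

noncomputable section

/-! ### Diamond graphs -/

/-- Replace every edge `uv` of `G` by a quadrilateral `u, a, v, b`: for each edge `e` of `G` two new
vertices `(e, false)`, `(e, true)` are added, each of them is joined to both ends of `e`, and the
edges of `G` are deleted. -/
def replaceEdges {V : Type} (G : SimpleGraph V) : SimpleGraph (V ⊕ (G.edgeSet × Bool)) where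
  Adj
    | .inl u, .inr (e, _) => u ∈ (e : Sym2 V)
    | .inr (e, _), .inl u => u ∈ (e : Sym2 V)
    | _, _ => False
  symm := ⟨by rintro (u | ⟨e, i⟩) (v | ⟨f, j⟩) h <;> exact h⟩
  loopless := ⟨by rintro (u | ⟨e, i⟩) h <;> exact h⟩

/-- The diamond graphs `D n`, bundled with their vertex sets. `D 0` is a single edge. -/
def diamond : ℕ → Σ V : Type, SimpleGraph V
  | 0 => ⟨Bool, ⊤⟩
  | n + 1 => ⟨_, replaceEdges (diamond n).2⟩

/-- The common vertex set of the diamond `D n` and of the weighted diamond `W n`. -/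
abbrev DiamondVertex (n : ℕ) : Type := (diamond n).1

/-! ### Weighted diamonds -/

/-- The underlying graph of `W n`: `W 0 = D 0` and `W (n + 1) = D (n + 1) ∪ W n`. -/
def weightedDiamond : (n : ℕ) → SimpleGraph (DiamondVertex n)
  | 0 => (diamond 0).2
  | n + 1 => (diamond (n + 1)).2 ⊔ (weightedDiamond n).map Function.Embedding.inl

/-- The weight in `W n` of the edge `uv` (the value is irrelevant if `uv` is not an edge). The edges
joining two old vertices keep their weight; all other edges of `W (n + 1)` are edges of `D (n + 1)`
and have weight `(1/2 + ε) ^ (n + 1)`. -/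
def edgeWeight (ε : ℝ) : (n : ℕ) → DiamondVertex n → DiamondVertex n → ℝ
  | 0 => fun _ _ => 1
  | n + 1 => fun
    | .inl u, .inl v => edgeWeight ε n u v
    | _, _ => (1 / 2 + ε) ^ (n + 1)

/-- The total weight of a walk in `W n`. -/
def walkWeight (ε : ℝ) {n : ℕ} {u v : DiamondVertex n} (p : (weightedDiamond n).Walk u v) : ℝ :=
  (p.darts.map fun a => edgeWeight ε n a.fst a.snd).sum

/-- The shortest path distance `d_W` of `W n`. -/
def weightedDiamondDist (ε : ℝ) (n : ℕ) (u v : DiamondVertex n) : ℝ :=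
  ⨅ p : (weightedDiamond n).Walk u v, walkWeight ε p

/-! ### Embeddings and their distortion -/

/-- The distortion of a map `f` from a set `V` with the metric `d` into a normed space: the product
of the best Lipschitz constants of `f` and of its inverse (as an extended nonnegative real). -/
def distortion {V X : Type*} [NormedAddCommGroup X] (d : V → V → ℝ) (f : V → X) : ℝ≥0∞ :=
  (⨆ (u : V) (v : V) (_ : u ≠ v), ENNReal.ofReal (‖f u - f v‖ / d u v)) *
    (⨆ (u : V) (v : V) (_ : u ≠ v), ENNReal.ofReal (d u v / ‖f u - f v‖))

/-- `V` with the metric `d` `D`-embeds into `X`: some injective map has distortion at most `D`. -/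
def DEmbeds {V : Type*} (D : ℝ) (d : V → V → ℝ) (X : Type*) [NormedAddCommGroup X] : Prop :=
  ∃ f : V → X, Function.Injective f ∧ distortion d f ≤ ENNReal.ofReal D

/-! ### Schauder bases, finite or infinite -/

/-- The basis constant of a basis indexed by an initial segment of `ℕ`: the supremum of the norms of
the partial sum projections. -/
def basisConstant {β : Type} [Preorder β] [LocallyFiniteOrderBot β] {𝕜 X : Type*} [RCLike 𝕜]
    [NormedAddCommGroup X] [NormedSpace 𝕜 X] {L : SummationFilter β}
    (b : GeneralSchauderBasis β 𝕜 X L) : ℝ≥0∞ :=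
  ⨆ j : β, ‖b.proj (Finset.Iic j)‖ₑ

/-- `X` has a Schauder basis with basis constant at most `C`: either a finite one `x_0, …, x_{d-1}`
(where expansions are finite sums), or an infinite sequence `x_0, x_1, …` such that every vector has
a norm convergent expansion. -/
def HasSchauderBasisLE (𝕜 X : Type*) [RCLike 𝕜] [NormedAddCommGroup X] [NormedSpace 𝕜 X]
    (C : ℝ) : Prop :=
  (∃ (d : ℕ) (b : GeneralSchauderBasis (Fin d) 𝕜 X (SummationFilter.unconditional (Fin d))),
      basisConstant b ≤ ENNReal.ofReal C) ∨
    ∃ b : SchauderBasis 𝕜 X, basisConstant b ≤ ENNReal.ofReal C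

end

/-!
The embedding is built level by level. It sends the two ends of the edge of `W 0` to `0` and to a
unit vector, and a new vertex `x` of level `n`, attached to the edge `uv` of `D (n - 1)`, to the
mean of the images of `u` and `v` plus `(1/2 + ε) ^ n` times a unit vector `y x` (`diamondMap`). The
vectors `y x` of level `n` are `1/16`-separated and lie in the `n`-th block of the basis, of length
`n + 1`: by a comparison of volumes the unit sphere of an `(n + 1)`-dimensional space contains
enough such vectors for the `2 * 4 ^ (n - 1)` new vertices (`exists_separated_family`). The levels
`0, …, n` use `(n + 1) * (n + 2) / 2` basis vectors, which fits into the given dimension because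
`W n` has more than `2/3 * 4 ^ n` vertices (`blockStart_le_ceil`).

The map is Lipschitz because an edge of level `n` is stretched at most half as much as an edge of
level `n - 1`, plus `(1/2 + ε) ^ n`; the factor `1/2` is smaller than the ratio `1/2 + ε` of the
weights, so the Lipschitz constants on the edges are bounded by a geometric series
(`norm_diamondMap_sub_le_of_adj`).

For the lower bound, fix a vertex `x` of `D n` and an edge of `D n` that contains it; for `k ≤ n` it
comes from an edge of `D k`, in which `x` has a relative position `s k ∈ [0, 1]`. A new vertex being
the mean of the ends of its edge, the component of the image of `x` in the `k`-th block is
`(1/2 + ε) ^ k * s k` times the direction of the new end of that edge (`diamondMap_addressEnd`).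
The projections onto the blocks are bounded by twice the basis constant, so it suffices to bound the
distance of `x` and `x'` by the largest difference of components
(`withinWalk_of_forall_component_le`). Let `m` be the last level at which both lie in the same edge.
If their positions at level `m` are not close, that level suffices. Otherwise either level `m + 1`
suffices, or both are close to a common end of their edges of level `m + 1`. On all finer levels
their directions are separated, so the differences control both positions, and the distance of
either vertex to the common end is controlled by the first position on a finer level that is not
small (`withinWalk_of_forall_position_le`).
-/

open scoped ENNReal

/-! ### Combinatorics of the diamonds -/

/-- The vertices of `D n` as vertices of `D (n + 1)`. -/
def oldVertex {n : ℕ} (x : DiamondVertex n) : DiamondVertex (n + 1) := Sum.inl x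

/-- The new vertices of `D (n + 1)`: two for each edge of `D n`. -/
def newVertex {n : ℕ} (e : (diamond n).2.edgeSet) (i : Bool) : DiamondVertex (n + 1) :=
  Sum.inr (e, i)

@[elab_as_elim]
theorem diamondVertex_succ_cases {n : ℕ} {P : DiamondVertex (n + 1) → Prop}
    (old : ∀ x, P (oldVertex x)) (new : ∀ e i, P (newVertex e i)) (x : DiamondVertex (n + 1)) :
    P x :=
  match x with
  | .inl x => old x
  | .inr (e, i) => new e i

theorem oldVertex_injective {n : ℕ} : Function.Injective (oldVertex (n := n)) :=
  Sum.inl_injective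

theorem newVertex_inj {n : ℕ} {e e' : (diamond n).2.edgeSet} {i i' : Bool} :
    newVertex e i = newVertex e' i' ↔ e = e' ∧ i = i' :=
  (Sum.inr_injective (α := DiamondVertex n)).eq_iff.trans Prod.mk_inj

theorem oldVertex_ne_newVertex {n : ℕ} (x : DiamondVertex n) (e : (diamond n).2.edgeSet)
    (i : Bool) : oldVertex x ≠ newVertex e i :=
  Sum.inl_ne_inr

theorem diamond_adj_old_new {n : ℕ} {x : DiamondVertex n} {e : (diamond n).2.edgeSet} {i : Bool} :
    (diamond (n + 1)).2.Adj (oldVertex x) (newVertex e i) ↔ x ∈ (e : Sym2 (DiamondVertex n)) :=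
  Iff.rfl

theorem diamond_not_adj_old_old {n : ℕ} {x y : DiamondVertex n} :
    ¬ (diamond (n + 1)).2.Adj (oldVertex x) (oldVertex y) :=
  id

theorem diamond_not_adj_new_new {n : ℕ} {e e' : (diamond n).2.edgeSet} {i i' : Bool} :
    ¬ (diamond (n + 1)).2.Adj (newVertex e i) (newVertex e' i') :=
  id

/-- Every edge of `D (n + 1)` is half of one of the two paths that replace an edge of `D n`. -/
theorem exists_eq_of_mem_edgeSet_succ {n : ℕ} (e : (diamond (n + 1)).2.edgeSet) :
    ∃ (d : (diamond n).2.edgeSet) (i : Bool) (x : DiamondVertex n), x ∈ (d : Sym2 _) ∧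
      (e : Sym2 (DiamondVertex (n + 1))) = s(oldVertex x, newVertex d i) := by
  obtain ⟨e, he⟩ := e
  induction e using Sym2.ind with
  | _ u v =>
  rw [SimpleGraph.mem_edgeSet] at he
  induction u using diamondVertex_succ_cases with
  | old x =>
    induction v using diamondVertex_succ_cases with
    | old y => exact (diamond_not_adj_old_old he).elim
    | new d i => exact ⟨d, i, x, diamond_adj_old_new.1 he, rfl⟩
  | new d i =>
    induction v using diamondVertex_succ_cases with
    | old x => exact ⟨d, i, x, diamond_adj_old_new.1 he.symm, Sym2.eq_swap⟩
    | new d' i' => exact (diamond_not_adj_new_new he).elim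

/-! ### Cardinalities -/

/-- An edge of `D (n + 1)` is an edge of `D n` with one of its ends and one of its two sides. -/
theorem card_diamond_edgeSet (n : ℕ) :
    Finite (diamond n).2.edgeSet ∧ Nat.card (diamond n).2.edgeSet = 4 ^ n := by
  induction n with
  | zero =>
    have h : (⊤ : SimpleGraph Bool).edgeSet = {s(false, true)} := by
      ext e
      induction e using Sym2.ind with
      | _ u v =>
        simp only [SimpleGraph.mem_edgeSet, SimpleGraph.top_adj, Set.mem_singleton_iff]
        revert u v
        decide
    change Finite (⊤ : SimpleGraph Bool).edgeSet ∧ Nat.card (⊤ : SimpleGraph Bool).edgeSet = _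
    rw [h]
    exact ⟨inferInstance, by simp⟩
  | succ n ih =>
    obtain ⟨_, hcard⟩ := ih
    let g : (Σ d : (diamond n).2.edgeSet, {x : DiamondVertex n // x ∈ (d : Sym2 _)}) × Bool →
        (diamond (n + 1)).2.edgeSet :=
      fun p => ⟨s(oldVertex p.1.2.1, newVertex p.1.1 p.2), (diamond_adj_old_new (i := p.2)).2 p.1.2.2⟩
    have hg : Function.Bijective g := by
      constructor
      · rintro ⟨⟨d, x, hx⟩, i⟩ ⟨⟨d', x', hx'⟩, i'⟩ h
        have h' := congrArg Subtype.val h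
        rcases Sym2.eq_iff.1 h' with ⟨h1, h2⟩ | ⟨h1, -⟩
        · obtain rfl := oldVertex_injective h1
          obtain ⟨rfl, rfl⟩ := newVertex_inj.1 h2
          rfl
        · exact (oldVertex_ne_newVertex _ _ _ h1).elim
      · intro e
        obtain ⟨d, i, x, hx, he⟩ := exists_eq_of_mem_edgeSet_succ e
        exact ⟨⟨⟨d, x, hx⟩, i⟩, Subtype.ext he.symm⟩
    have hends : ∀ d : (diamond n).2.edgeSet,
        Finite {x : DiamondVertex n // x ∈ (d : Sym2 _)} ∧
          Nat.card {x : DiamondVertex n // x ∈ (d : Sym2 _)} = 2 := by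
      rintro ⟨d, hd⟩
      induction d using Sym2.ind with
      | _ u v =>
        have huv : u ≠ v := SimpleGraph.Adj.ne hd
        have h : {x | x ∈ s(u, v)} = ({u, v} : Set (DiamondVertex n)) := by
          ext x
          simp
        change Finite ↥{x | x ∈ s(u, v)} ∧ Nat.card ↥{x | x ∈ s(u, v)} = 2
        rw [h]
        exact ⟨inferInstance, by rw [Nat.card_coe_set_eq, Set.ncard_pair huv]⟩
    have := fun d => (hends d).1
    have := Fintype.ofFinite (diamond n).2.edgeSet
    refine ⟨Finite.of_surjective g hg.2, ?_⟩
    rw [← Nat.card_congr (Equiv.ofBijective g hg), Nat.card_prod, Nat.card_sigma]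
    simp only [hends, Finset.sum_const, Finset.card_univ, smul_eq_mul, Nat.card_eq_fintype_card,
      Fintype.card_bool]
    rw [← Nat.card_eq_fintype_card, hcard]
    ring

instance (n : ℕ) : Finite (diamond n).2.edgeSet := (card_diamond_edgeSet n).1

theorem three_mul_card_diamondVertex (n : ℕ) :
    Finite (DiamondVertex n) ∧ 3 * Nat.card (DiamondVertex n) = 2 * 4 ^ n + 4 := by
  induction n with
  | zero =>
    change Finite Bool ∧ 3 * Nat.card Bool = _
    exact ⟨inferInstance, by simp⟩
  | succ n ih =>
    obtain ⟨_, hcard⟩ := ih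
    change Finite (DiamondVertex n ⊕ ((diamond n).2.edgeSet × Bool)) ∧
      3 * Nat.card (DiamondVertex n ⊕ ((diamond n).2.edgeSet × Bool)) = _
    refine ⟨inferInstance, ?_⟩
    rw [Nat.card_sum, Nat.card_prod, (card_diamond_edgeSet n).2, mul_add, hcard]
    simp
    ring

/-! ### Addresses of edges -/

/-- The edge of `D k` with address `a`, as an ordered pair: at each step, `a` tells which of the two
paths replacing the edge is taken, and from which end of the edge. -/
def addressDart (a : ℕ → Bool × Bool) : (k : ℕ) → (diamond k).2.Dart
  | 0 => ⟨(false, true), Bool.false_ne_true⟩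
  | k + 1 =>
    ⟨(oldVertex (if (a k).2 then (addressDart a k).snd else (addressDart a k).fst),
      newVertex ⟨(addressDart a k).edge, (addressDart a k).edge_mem⟩ (a k).1), by
        rw [diamond_adj_old_new]
        rcases (a k).2
        · exact Sym2.mem_mk_left _ _
        · exact Sym2.mem_mk_right _ _⟩

/-- The edge of `D k` with address `a`. -/
def addressEdge (a : ℕ → Bool × Bool) (k : ℕ) : (diamond k).2.edgeSet :=
  ⟨(addressDart a k).edge, (addressDart a k).edge_mem⟩

/-- The ends of the edge of `D k` with address `a`. For `k ≥ 1`, the end with index `true` is the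
vertex that is new in `D k`. -/
def addressEnd (a : ℕ → Bool × Bool) (k : ℕ) (σ : Bool) : DiamondVertex k :=
  if σ then (addressDart a k).snd else (addressDart a k).fst

theorem addressEnd_zero (a : ℕ → Bool × Bool) (σ : Bool) :
    addressEnd a 0 σ = (show DiamondVertex 0 from σ) := by
  cases σ <;> rfl

theorem addressEnd_succ_false (a : ℕ → Bool × Bool) (k : ℕ) :
    addressEnd a (k + 1) false = oldVertex (addressEnd a k (a k).2) := rfl

theorem addressEnd_succ_true (a : ℕ → Bool × Bool) (k : ℕ) :
    addressEnd a (k + 1) true = newVertex (addressEdge a k) (a k).1 := rfl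

theorem addressEdge_eq (a : ℕ → Bool × Bool) (k : ℕ) :
    (addressEdge a k : Sym2 (DiamondVertex k)) = s(addressEnd a k false, addressEnd a k true) := rfl

theorem addressEnd_adj (a : ℕ → Bool × Bool) (k : ℕ) :
    (diamond k).2.Adj (addressEnd a k false) (addressEnd a k true) :=
  (addressDart a k).adj

theorem addressDart_congr {a a' : ℕ → Bool × Bool} {k : ℕ} (h : ∀ j < k, a j = a' j) :
    addressDart a k = addressDart a' k := by
  induction k with
  | zero => rfl
  | succ k ih =>
    have := ih fun j hj => h j (hj.trans k.lt_succ_self)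
    simp only [addressDart, this, h k k.lt_succ_self]

theorem addressEnd_congr {a a' : ℕ → Bool × Bool} {k : ℕ} (h : ∀ j < k, a j = a' j) (σ : Bool) :
    addressEnd a k σ = addressEnd a' k σ := by
  rw [addressEnd, addressEnd, addressDart_congr h]

theorem addressEdge_congr {a a' : ℕ → Bool × Bool} {k : ℕ} (h : ∀ j < k, a j = a' j) :
    addressEdge a k = addressEdge a' k := by
  unfold addressEdge
  rw [Subtype.mk.injEq, addressDart_congr h]

/-- An edge determines its address. -/
theorem addressEdge_inj {a a' : ℕ → Bool × Bool} {k : ℕ} (h : addressEdge a k = addressEdge a' k) :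
    ∀ j < k, a j = a' j := by
  induction k with
  | zero => simp
  | succ k ih =>
    have h' := congrArg Subtype.val h
    rw [addressEdge_eq, addressEdge_eq] at h'
    simp only [addressEnd_succ_false, addressEnd_succ_true] at h'
    rcases Sym2.eq_iff.1 h' with ⟨h1, h2⟩ | ⟨h1, -⟩
    · obtain ⟨h3, h4⟩ := newVertex_inj.1 h2
      have hlt := ih h3
      rw [addressEnd_congr hlt] at h1
      have h5 := oldVertex_injective h1
      have h6 : (a k).2 = (a' k).2 := by
        have hne := (addressEnd_adj a' k).ne
        revert h5
        rcases (a k).2 <;> rcases (a' k).2 <;> intro h5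
        · rfl
        · exact (hne h5).elim
        · exact (hne h5.symm).elim
        · rfl
      intro j hj
      rcases Nat.lt_succ_iff_lt_or_eq.1 hj with hj | rfl
      · exact hlt j hj
      · exact Prod.ext h4 h6
    · exact (oldVertex_ne_newVertex _ _ _ h1).elim

theorem exists_addressEdge_eq {n : ℕ} (e : (diamond n).2.edgeSet) :
    ∃ a : ℕ → Bool × Bool, addressEdge a n = e := by
  induction n with
  | zero =>
    refine ⟨fun _ => (false, false), Subtype.ext ?_⟩
    obtain ⟨e, he⟩ := e
    induction e using Sym2.ind with
    | _ u v =>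
      have h : ∀ u v : Bool, u ≠ v → s(false, true) = s(u, v) := by decide
      exact h u v he
  | succ n ih =>
    obtain ⟨d, i, x, hx, he⟩ := exists_eq_of_mem_edgeSet_succ e
    obtain ⟨a, rfl⟩ := ih d
    obtain ⟨c, rfl⟩ : ∃ c, addressEnd a n c = x := by
      rw [addressEdge_eq, Sym2.mem_iff] at hx
      rcases hx with rfl | rfl
      exacts [⟨_, rfl⟩, ⟨_, rfl⟩]
    refine ⟨Function.update a n (i, c), Subtype.ext ?_⟩
    have hlt : ∀ j < n, Function.update a n (i, c) j = a j := fun j hj =>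
      Function.update_of_ne hj.ne _ _
    rw [he, addressEdge_eq, addressEnd_succ_false, addressEnd_succ_true, addressEnd_congr hlt,
      addressEdge_congr hlt, Function.update_self]

/-- Every vertex of `D n` is an end of an edge. -/
theorem exists_addressEnd_eq {n : ℕ} (x : DiamondVertex n) :
    ∃ (a : ℕ → Bool × Bool) (σ : Bool), addressEnd a n σ = x := by
  induction n with
  | zero => exact ⟨fun _ => (false, false), x, addressEnd_zero _ _⟩
  | succ n ih =>
    induction x using diamondVertex_succ_cases with
    | old x =>
      obtain ⟨a, σ, rfl⟩ := ih x
      refine ⟨Function.update a n (false, σ), false, ?_⟩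
      have hlt : ∀ j < n, Function.update a n (false, σ) j = a j := fun j hj =>
        Function.update_of_ne hj.ne _ _
      rw [addressEnd_succ_false, addressEnd_congr hlt, Function.update_self]
    | new e i =>
      obtain ⟨a, rfl⟩ := exists_addressEdge_eq e
      refine ⟨Function.update a n (i, false), true, ?_⟩
      have hlt : ∀ j < n, Function.update a n (i, false) j = a j := fun j hj =>
        Function.update_of_ne hj.ne _ _
      rw [addressEnd_succ_true, addressEdge_congr hlt, Function.update_self]

/-- The vertices of `D k` as vertices of `D n`, `n ≥ k`. -/
def embedVertex {k n : ℕ} (h : k ≤ n) (x : DiamondVertex k) : DiamondVertex n :=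
  Nat.leRecOn h (fun {_} => oldVertex) x

theorem embedVertex_self {n : ℕ} (x : DiamondVertex n) : embedVertex le_rfl x = x :=
  Nat.leRecOn_self _

theorem embedVertex_succ {k n : ℕ} (h : k ≤ n) (x : DiamondVertex k) :
    embedVertex (h.trans n.le_succ) x = oldVertex (embedVertex h x) :=
  Nat.leRecOn_succ h _

theorem embedVertex_oldVertex {k n : ℕ} (h : k + 1 ≤ n) (x : DiamondVertex k) :
    embedVertex h (oldVertex x) = embedVertex (k.le_succ.trans h) x :=
  Nat.leRecOn_succ_left x (k.le_succ.trans h) h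

/-! ### Short walks in the weighted diamonds -/

theorem edgeWeight_comm (ε : ℝ) {n : ℕ} (u v : DiamondVertex n) :
    edgeWeight ε n u v = edgeWeight ε n v u := by
  induction n with
  | zero => rfl
  | succ n ih =>
    induction u using diamondVertex_succ_cases with
    | old x =>
      induction v using diamondVertex_succ_cases with
      | old y => exact ih x y
      | new d i => rfl
    | new d i =>
      induction v using diamondVertex_succ_cases with
      | old y => rfl
      | new d i => rfl

theorem edgeWeight_of_adj (ε : ℝ) {n : ℕ} {u v : DiamondVertex n} (h : (diamond n).2.Adj u v) :
    edgeWeight ε n u v = (1 / 2 + ε) ^ n := by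
  cases n with
  | zero => rw [pow_zero]; rfl
  | succ n =>
    induction u using diamondVertex_succ_cases with
    | old x =>
      induction v using diamondVertex_succ_cases with
      | old y => exact (diamond_not_adj_old_old h).elim
      | new d i => rfl
    | new d i => rfl

theorem pow_le_edgeWeight {ε : ℝ} (hε : ε ∈ Set.Ioo (0 : ℝ) (1 / 2)) {n : ℕ}
    (u v : DiamondVertex n) : (1 / 2 + ε) ^ n ≤ edgeWeight ε n u v := by
  obtain ⟨h0, h1⟩ := hε
  induction n with
  | zero => rw [pow_zero]; rfl
  | succ n ih =>
    induction u using diamondVertex_succ_cases with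
    | old x =>
      induction v using diamondVertex_succ_cases with
      | old y =>
        exact (pow_le_pow_of_le_one (by linarith) (by linarith) n.le_succ).trans (ih x y)
      | new d i => rfl
    | new d i => rfl

theorem edgeWeight_nonneg {ε : ℝ} (hε : ε ∈ Set.Ioo (0 : ℝ) (1 / 2)) {n : ℕ}
    (u v : DiamondVertex n) : 0 ≤ edgeWeight ε n u v :=
  le_trans (pow_nonneg (by linarith [hε.1]) n) (pow_le_edgeWeight hε u v)

theorem diamond_le_weightedDiamond (n : ℕ) : (diamond n).2 ≤ weightedDiamond n := by
  cases n with
  | zero => exact le_rfl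
  | succ n => exact le_sup_left

theorem weightedDiamond_adj_oldVertex {n : ℕ} {u v : DiamondVertex n} :
    (weightedDiamond (n + 1)).Adj (oldVertex u) (oldVertex v) ↔ (weightedDiamond n).Adj u v := by
  refine SimpleGraph.sup_adj _ _ _ _ |>.trans ?_
  constructor
  · rintro (h | h)
    · exact (diamond_not_adj_old_old h).elim
    · exact (SimpleGraph.map_adj_apply (f := Function.Embedding.inl)).1 h
  · exact fun h => .inr ((SimpleGraph.map_adj_apply (f := Function.Embedding.inl)).2 h)

theorem walkWeight_nonneg {ε : ℝ} (hε : ε ∈ Set.Ioo (0 : ℝ) (1 / 2)) {n : ℕ}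
    {u v : DiamondVertex n} (p : (weightedDiamond n).Walk u v) : 0 ≤ walkWeight ε p :=
  List.sum_nonneg fun x hx => by
    obtain ⟨a, -, rfl⟩ := List.mem_map.1 hx
    exact edgeWeight_nonneg hε _ _

theorem walkWeight_cons (ε : ℝ) {n : ℕ} {u v w : DiamondVertex n}
    (h : (weightedDiamond n).Adj u v) (p : (weightedDiamond n).Walk v w) :
    walkWeight ε (.cons h p) = edgeWeight ε n u v + walkWeight ε p := by
  simp [walkWeight]

theorem pow_le_walkWeight {ε : ℝ} (hε : ε ∈ Set.Ioo (0 : ℝ) (1 / 2)) {n : ℕ}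
    {u v : DiamondVertex n} (huv : u ≠ v) (p : (weightedDiamond n).Walk u v) :
    (1 / 2 + ε) ^ n ≤ walkWeight ε p := by
  cases p with
  | nil => exact (huv rfl).elim
  | @cons _ w _ h p =>
    rw [walkWeight_cons]
    linarith [pow_le_edgeWeight hε u w, walkWeight_nonneg hε p]

/-- Some walk from `u` to `v` in `W n` has weight at most `r`. -/
def WithinWalk (ε : ℝ) {n : ℕ} (u v : DiamondVertex n) (r : ℝ) : Prop :=
  ∃ p : (weightedDiamond n).Walk u v, walkWeight ε p ≤ r

theorem WithinWalk.refl (ε : ℝ) {n : ℕ} (u : DiamondVertex n) {r : ℝ} (hr : 0 ≤ r) :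
    WithinWalk ε u u r :=
  ⟨.nil, by simpa [walkWeight] using hr⟩

theorem WithinWalk.mono {ε : ℝ} {n : ℕ} {u v : DiamondVertex n} {r s : ℝ}
    (h : WithinWalk ε u v r) (hrs : r ≤ s) : WithinWalk ε u v s :=
  let ⟨p, hp⟩ := h
  ⟨p, hp.trans hrs⟩

theorem WithinWalk.trans {ε : ℝ} {n : ℕ} {u v w : DiamondVertex n} {r s : ℝ}
    (h : WithinWalk ε u v r) (h' : WithinWalk ε v w s) : WithinWalk ε u w (r + s) := by
  obtain ⟨p, hp⟩ := h
  obtain ⟨q, hq⟩ := h'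
  refine ⟨p.append q, ?_⟩
  have : walkWeight ε (p.append q) = walkWeight ε p + walkWeight ε q := by
    simp [walkWeight]
  linarith

theorem WithinWalk.symm {ε : ℝ} {n : ℕ} {u v : DiamondVertex n} {r : ℝ}
    (h : WithinWalk ε u v r) : WithinWalk ε v u r := by
  obtain ⟨p, hp⟩ := h
  refine ⟨p.reverse, ?_⟩
  have : walkWeight ε p.reverse = walkWeight ε p := by
    simp [walkWeight, Function.comp_def, edgeWeight_comm ε, List.sum_reverse]
  rwa [this]

theorem WithinWalk.of_adj (ε : ℝ) {n : ℕ} {u v : DiamondVertex n} (h : (diamond n).2.Adj u v) :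
    WithinWalk ε u v ((1 / 2 + ε) ^ n) :=
  ⟨(diamond_le_weightedDiamond n h).toWalk, by simp [walkWeight, edgeWeight_of_adj ε h]⟩

theorem WithinWalk.oldVertex {ε : ℝ} {n : ℕ} {u v : DiamondVertex n} {r : ℝ}
    (h : WithinWalk ε u v r) : WithinWalk ε (oldVertex u) (oldVertex v) r := by
  obtain ⟨p, hp⟩ := h
  induction p generalizing r with
  | nil => exact .refl _ _ (by simpa [walkWeight] using hp)
  | cons h p ih =>
    rw [walkWeight_cons] at hp
    obtain ⟨q, hq⟩ := ih le_rfl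
    refine ⟨.cons (weightedDiamond_adj_oldVertex.2 h) q, ?_⟩
    rw [walkWeight_cons]
    exact (add_le_add le_rfl hq).trans hp

theorem WithinWalk.addressEnd (ε : ℝ) (a : ℕ → Bool × Bool) {k : ℕ} (σ τ : Bool)
    (hε : 0 ≤ 1 / 2 + ε) :
    WithinWalk ε (addressEnd a k σ) (addressEnd a k τ) ((1 / 2 + ε) ^ k) := by
  have h := WithinWalk.of_adj ε (addressEnd_adj a k)
  cases σ <;> cases τ
  · exact .refl _ _ (pow_nonneg hε k)
  · exact h
  · exact h.symm
  · exact .refl _ _ (pow_nonneg hε k)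

theorem WithinWalk.embedVertex {ε : ℝ} {k n : ℕ} (hk : k ≤ n) {u v : DiamondVertex k} {r : ℝ}
    (h : WithinWalk ε u v r) : WithinWalk ε (embedVertex hk u) (embedVertex hk v) r := by
  induction n, hk using Nat.le_induction with
  | base => rwa [embedVertex_self, embedVertex_self]
  | succ n hk ih =>
    rw [embedVertex_succ hk, embedVertex_succ hk]
    exact ih.oldVertex

/-- The part of `W n` that replaces an edge of `D k` is as small as that edge: the distances to the
ends of the edge are at most the sum of the weights of all levels from `k` on. -/
theorem withinWalk_addressEnd_embedVertex {ε : ℝ} (hε : ε ∈ Set.Ioo (0 : ℝ) (1 / 2))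
    (a : ℕ → Bool × Bool) {k n : ℕ} (hk : k ≤ n) (σ τ : Bool) :
    WithinWalk ε (addressEnd a n σ) (embedVertex hk (addressEnd a k τ))
      ((1 / 2 + ε) ^ k / (1 / 2 - ε)) := by
  obtain ⟨h0, h1⟩ := hε
  have h2 : 0 < 1 / 2 - ε := by linarith
  induction hk using Nat.decreasingInduction generalizing τ with
  | self =>
    rw [embedVertex_self]
    refine (WithinWalk.addressEnd ε a σ τ (by linarith)).mono ?_
    exact le_div_self (by positivity) h2 (by linarith)
  | of_succ k hk ih =>
    have h3 := ih false
    rw [addressEnd_succ_false, embedVertex_oldVertex hk] at h3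
    refine (h3.trans ((WithinWalk.addressEnd ε a (a k).2 τ (by linarith)).embedVertex _)).mono ?_
    rw [div_add' _ _ _ h2.ne', pow_succ]
    apply le_of_eq
    ring

theorem weightedDiamond_nonempty_walk {n : ℕ} (u v : DiamondVertex n) :
    Nonempty ((weightedDiamond n).Walk u v) := by
  obtain ⟨a, σ, rfl⟩ := exists_addressEnd_eq u
  obtain ⟨b, τ, rfl⟩ := exists_addressEnd_eq v
  have hε : (1 / 4 : ℝ) ∈ Set.Ioo (0 : ℝ) (1 / 2) := by norm_num
  have h1 := withinWalk_addressEnd_embedVertex hε a n.zero_le σ false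
  have h2 := withinWalk_addressEnd_embedVertex hε b n.zero_le τ false
  rw [addressEnd_zero] at h1 h2
  obtain ⟨p, -⟩ := h1.trans h2.symm
  exact ⟨p⟩

theorem weightedDiamondDist_le_of_withinWalk {ε : ℝ} (hε : ε ∈ Set.Ioo (0 : ℝ) (1 / 2)) {n : ℕ}
    {u v : DiamondVertex n} {r : ℝ} (h : WithinWalk ε u v r) : weightedDiamondDist ε n u v ≤ r := by
  obtain ⟨p, hp⟩ := h
  exact (ciInf_le ⟨0, by rintro _ ⟨q, rfl⟩; exact walkWeight_nonneg hε q⟩ p).trans hp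

theorem weightedDiamondDist_nonneg {ε : ℝ} (hε : ε ∈ Set.Ioo (0 : ℝ) (1 / 2)) {n : ℕ}
    (u v : DiamondVertex n) : 0 ≤ weightedDiamondDist ε n u v :=
  Real.iInf_nonneg fun p => walkWeight_nonneg hε p

theorem not_withinWalk_zero {ε : ℝ} (hε : ε ∈ Set.Ioo (0 : ℝ) (1 / 2)) {n : ℕ}
    {u v : DiamondVertex n} (huv : u ≠ v) : ¬ WithinWalk ε u v 0 := by
  rintro ⟨p, hp⟩
  have := pow_le_walkWeight hε huv p
  have h : 0 < (1 / 2 + ε) ^ n := pow_pos (by linarith [hε.1]) n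
  linarith

/-- A function on `W n` that is Lipschitz on each edge is Lipschitz. -/
theorem norm_sub_le_mul_weightedDiamondDist {ε : ℝ} {n : ℕ} {X : Type*} [NormedAddCommGroup X]
    {f : DiamondVertex n → X} {L : ℝ} (hL : 0 < L)
    (hf : ∀ u v, (weightedDiamond n).Adj u v → ‖f u - f v‖ ≤ L * edgeWeight ε n u v)
    (u v : DiamondVertex n) : ‖f u - f v‖ ≤ L * weightedDiamondDist ε n u v := by
  have hwalk : ∀ {u v : DiamondVertex n} (p : (weightedDiamond n).Walk u v),
      ‖f u - f v‖ ≤ L * walkWeight ε p := by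
    intro u v p
    induction p with
    | nil => simp [walkWeight]
    | cons h p ih =>
      rw [walkWeight_cons, mul_add]
      exact (norm_sub_le_norm_sub_add_norm_sub _ _ _).trans (add_le_add (hf _ _ h) ih)
  have := weightedDiamond_nonempty_walk u v
  rw [← div_le_iff₀' hL]
  exact le_ciInf fun p => (div_le_iff₀' hL).2 (hwalk p)

/-! ### The embedding -/

section Embedding

variable {X : Type*} [NormedAddCommGroup X] [NormedSpace ℝ X]

/-- The mean of the values of `g` at the two ends of an edge. -/
noncomputable def edgeMean {V : Type*} (g : V → X) : Sym2 V → X :=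
  Sym2.lift ⟨fun u v => (1 / 2 : ℝ) • (g u + g v), fun u v => by simp only [add_comm]⟩

theorem edgeMean_mk {V : Type*} (g : V → X) (u v : V) :
    edgeMean g s(u, v) = (1 / 2 : ℝ) • (g u + g v) := rfl

/-- The map `W n → X` with directions `y`: a new vertex of level `n + 1` is sent to the mean of the
images of the ends of its edge, moved by `(1/2 + ε) ^ (n + 1)` in its own direction. -/
noncomputable def diamondMap (ε : ℝ) (y₀ : X) (y : ∀ n, (diamond n).2.edgeSet → Bool → X) :
    (n : ℕ) → DiamondVertex n → X
  | 0 => fun b : Bool => if b then y₀ else 0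
  | n + 1 => Sum.elim (diamondMap ε y₀ y n) fun p : (diamond n).2.edgeSet × Bool =>
      edgeMean (diamondMap ε y₀ y n) p.1 + ((1 / 2 + ε) ^ (n + 1)) • y n p.1 p.2

variable {ε : ℝ} {y₀ : X} {y : ∀ n, (diamond n).2.edgeSet → Bool → X}

theorem diamondMap_oldVertex {n : ℕ} (x : DiamondVertex n) :
    diamondMap ε y₀ y (n + 1) (oldVertex x) = diamondMap ε y₀ y n x := rfl

theorem diamondMap_newVertex {n : ℕ} (e : (diamond n).2.edgeSet) (i : Bool) :
    diamondMap ε y₀ y (n + 1) (newVertex e i) =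
      edgeMean (diamondMap ε y₀ y n) e + ((1 / 2 + ε) ^ (n + 1)) • y n e i := rfl

/-- The halves of an edge of `D n` are stretched half as much as the edge, plus `(1/2 + ε) ^ (n + 1)`;
since `1/2 < 1/2 + ε`, the Lipschitz constants on the edges of the `D n` remain bounded. -/
theorem norm_diamondMap_sub_le_of_diamond_adj (hε : ε ∈ Set.Ioo (0 : ℝ) (1 / 2)) (hy₀ : ‖y₀‖ ≤ 1)
    {n : ℕ} (hy : ∀ j < n, ∀ e i, ‖y j e i‖ ≤ 1) {u v : DiamondVertex n}
    (huv : (diamond n).2.Adj u v) :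
    ‖diamondMap ε y₀ y n u - diamondMap ε y₀ y n v‖ ≤ (1 / 2 + ε) / ε * (1 / 2 + ε) ^ n := by
  obtain ⟨h0, h1⟩ := hε
  induction n with
  | zero =>
    have hL : 1 ≤ (1 / 2 + ε) / ε := by rw [le_div_iff₀ h0]; linarith
    rw [pow_zero, mul_one]
    refine le_trans ?_ hL
    have h : ∀ u v : Bool, u ≠ v → ‖(if u then y₀ else 0) - (if v then y₀ else 0)‖ ≤ 1 := by
      intro u v h
      cases u <;> cases v <;> simp_all
    exact h u v huv
  | succ n ih =>
    have key : ∀ (x : DiamondVertex n) (e : (diamond n).2.edgeSet) (i : Bool),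
        x ∈ (e : Sym2 (DiamondVertex n)) →
        ‖diamondMap ε y₀ y (n + 1) (oldVertex x) - diamondMap ε y₀ y (n + 1) (newVertex e i)‖ ≤
          (1 / 2 + ε) / ε * (1 / 2 + ε) ^ (n + 1) := by
      rintro x ⟨e, he⟩ i hx
      obtain ⟨z, rfl⟩ := Sym2.mem_iff_exists.1 hx
      have h2 := ih (fun j hj => hy j (hj.trans n.lt_succ_self)) (u := x) (v := z) he
      have h3 := hy n n.lt_succ_self ⟨s(x, z), he⟩ i
      rw [diamondMap_oldVertex, diamondMap_newVertex, edgeMean_mk]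
      set g := diamondMap ε y₀ y n
      have h4 : g x - ((1 / 2 : ℝ) • (g x + g z) + ((1 / 2 + ε) ^ (n + 1)) • y n ⟨s(x, z), he⟩ i) =
          (1 / 2 : ℝ) • (g x - g z) - ((1 / 2 + ε) ^ (n + 1)) • y n ⟨s(x, z), he⟩ i := by
        module
      have h5 : 0 < (1 / 2 + ε) ^ (n + 1) := by positivity
      rw [h4]
      refine (norm_sub_le _ _).trans ?_
      rw [norm_smul, norm_smul, Real.norm_of_nonneg h5.le, Real.norm_of_nonneg (by norm_num)]
      calc 1 / 2 * ‖g x - g z‖ + (1 / 2 + ε) ^ (n + 1) * ‖y n ⟨s(x, z), he⟩ i‖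
          ≤ 1 / 2 * ((1 / 2 + ε) / ε * (1 / 2 + ε) ^ n) + (1 / 2 + ε) ^ (n + 1) * 1 := by gcongr
        _ = (1 / 2 + ε) / ε * (1 / 2 + ε) ^ (n + 1) := by
          field_simp
          ring
    induction u using diamondVertex_succ_cases with
    | old x =>
      induction v using diamondVertex_succ_cases with
      | old y => exact (diamond_not_adj_old_old huv).elim
      | new d i => exact key x d i (diamond_adj_old_new.1 huv)
    | new d i =>
      induction v using diamondVertex_succ_cases with
      | old x =>
        rw [norm_sub_rev]
        exact key x d i (diamond_adj_old_new.1 huv.symm)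
      | new d' i' => exact (diamond_not_adj_new_new huv).elim

theorem norm_diamondMap_sub_le_of_adj (hε : ε ∈ Set.Ioo (0 : ℝ) (1 / 2)) (hy₀ : ‖y₀‖ ≤ 1)
    {n : ℕ} (hy : ∀ j < n, ∀ e i, ‖y j e i‖ ≤ 1) {u v : DiamondVertex n}
    (huv : (weightedDiamond n).Adj u v) :
    ‖diamondMap ε y₀ y n u - diamondMap ε y₀ y n v‖ ≤ (1 / 2 + ε) / ε * edgeWeight ε n u v := by
  induction n with
  | zero =>
    have h := norm_diamondMap_sub_le_of_diamond_adj hε hy₀ hy (u := u) (v := v) huv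
    rwa [pow_zero] at h
  | succ n ih =>
    have h : (diamond (n + 1)).2.Adj u v ∨
        ∃ x z, (weightedDiamond n).Adj x z ∧ oldVertex x = u ∧ oldVertex z = v :=
      ((SimpleGraph.sup_adj _ _ _ _).1 huv).imp_right (SimpleGraph.map_adj _ _ _ _).1
    rcases h with h | ⟨x, z, h, rfl, rfl⟩
    · rw [edgeWeight_of_adj ε h]
      exact norm_diamondMap_sub_le_of_diamond_adj hε hy₀ hy h
    · exact ih (fun j hj => hy j (hj.trans n.lt_succ_self)) h

/-! ### Positions along the edges -/

/-- The relative position in `[0, 1]` of the vertex `addressEnd a n σ` of `D n` between the ends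
`addressEnd a k false` and `addressEnd a k true` of the edge of `D k` that it comes from (`k ≤ n`):
a new vertex is half-way between the ends of its edge. -/
noncomputable def addressPosition (a : ℕ → Bool × Bool) (n : ℕ) (σ : Bool) (k : ℕ) : ℝ :=
  if k < n then
    if (a k).2 then 1 - addressPosition a n σ (k + 1) / 2 else addressPosition a n σ (k + 1) / 2
  else if σ then 1 else 0
termination_by n - k

theorem addressPosition_self (a : ℕ → Bool × Bool) (n : ℕ) (σ : Bool) :
    addressPosition a n σ n = if σ then 1 else 0 := by
  rw [addressPosition, if_neg (lt_irrefl n)]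

theorem addressPosition_of_lt (a : ℕ → Bool × Bool) {n k : ℕ} (σ : Bool) (h : k < n) :
    addressPosition a n σ k =
      if (a k).2 then 1 - addressPosition a n σ (k + 1) / 2
      else addressPosition a n σ (k + 1) / 2 := by
  rw [addressPosition, if_pos h]

theorem addressPosition_mem (a : ℕ → Bool × Bool) {n k : ℕ} (σ : Bool) (h : k ≤ n) :
    addressPosition a n σ k ∈ Set.Icc (0 : ℝ) 1 := by
  induction h using Nat.decreasingInduction with
  | self =>
    rw [addressPosition_self]
    cases σ <;> simp
  | of_succ k hk ih =>
    rw [addressPosition_of_lt a σ hk]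
    obtain ⟨h0, h1⟩ := ih
    constructor <;> split_ifs <;> linarith

/-- The direction of level `k` along the address `a`: the one of the end `addressEnd a k true`. -/
def addressDirection (y₀ : X) (y : ∀ n, (diamond n).2.edgeSet → Bool → X) (a : ℕ → Bool × Bool) :
    ℕ → X
  | 0 => y₀
  | k + 1 => y k (addressEdge a k) (a k).1

theorem diamondMap_addressEnd_succ_true (a : ℕ → Bool × Bool) (k : ℕ) :
    diamondMap ε y₀ y (k + 1) (addressEnd a (k + 1) true) =
      (1 / 2 : ℝ) • (diamondMap ε y₀ y k (addressEnd a k false) +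
        diamondMap ε y₀ y k (addressEnd a k true)) +
      ((1 / 2 + ε) ^ (k + 1)) • addressDirection y₀ y a (k + 1) := by
  rw [addressEnd_succ_true, diamondMap_newVertex, addressEdge_eq, edgeMean_mk]
  rfl

theorem diamondMap_addressEnd_eq_add_sum (a : ℕ → Bool × Bool) {n k : ℕ} (σ : Bool) (h : k ≤ n) :
    diamondMap ε y₀ y n (addressEnd a n σ) =
      (1 - addressPosition a n σ k) • diamondMap ε y₀ y k (addressEnd a k false) +
        addressPosition a n σ k • diamondMap ε y₀ y k (addressEnd a k true) +
        ∑ j ∈ Finset.Ico (k + 1) (n + 1),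
          ((1 / 2 + ε) ^ j * addressPosition a n σ j) • addressDirection y₀ y a j := by
  induction h using Nat.decreasingInduction with
  | self =>
    rw [addressPosition_self, Finset.Ico_self, Finset.sum_empty]
    cases σ <;> simp
  | of_succ k hk ih =>
    rw [ih, Finset.sum_eq_sum_Ico_succ_bot (by omega : k + 1 < n + 1), addressPosition_of_lt a σ hk,
      diamondMap_addressEnd_succ_true, addressEnd_succ_false, diamondMap_oldVertex]
    rcases (a k).2 <;> simp only [if_true, if_false, Bool.false_eq_true] <;> module

/-- The image of a vertex is a combination of one direction of each level. -/
theorem diamondMap_addressEnd (a : ℕ → Bool × Bool) (n : ℕ) (σ : Bool) :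
    diamondMap ε y₀ y n (addressEnd a n σ) =
      ∑ j ∈ Finset.range (n + 1),
        ((1 / 2 + ε) ^ j * addressPosition a n σ j) • addressDirection y₀ y a j := by
  have h0 : diamondMap ε y₀ y 0 (addressEnd a 0 false) = 0 := rfl
  have h1 : diamondMap ε y₀ y 0 (addressEnd a 0 true) = y₀ := rfl
  rw [diamondMap_addressEnd_eq_add_sum a σ n.zero_le, h0, h1, Finset.range_eq_Ico,
    Finset.sum_eq_sum_Ico_succ_bot n.succ_pos, smul_zero, zero_add, pow_zero, one_mul]
  rfl

end Embedding

/-! ### The distance is detected by the levels -/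

/-- If a vertex is not close to the other end, its distance to the end `τ` of its edge of level `k`
is controlled by the positions of the vertex on the finer levels: at the first level where the
position is not close to `0`, the vertex is still in an edge with end `τ`. -/
theorem withinWalk_of_forall_position_le {ε : ℝ} (hε : ε ∈ Set.Ioo (0 : ℝ) (1 / 2))
    (a : ℕ → Bool × Bool) {k n : ℕ} (hk : k ≤ n) (σ τ : Bool) {B : ℝ} (hB : 0 ≤ B)
    (hle : ∀ j, k < j → j ≤ n → (1 / 2 + ε) ^ j * addressPosition a n σ j ≤ B)
    (hpos : |addressPosition a n σ k - if τ then 1 else 0| ≤ 3 / 4) :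
    WithinWalk ε (addressEnd a n σ) (embedVertex hk (addressEnd a k τ))
      (4 / ((1 / 2 - ε) * (1 / 2 + ε)) * B) := by
  have ⟨h0, h1⟩ := hε
  have h2 : 0 < 1 / 2 - ε := by linarith
  have h3 : 0 < 1 / 2 + ε := by linarith
  induction hk using Nat.decreasingInduction generalizing τ with
  | self =>
    rw [addressPosition_self] at hpos
    rw [embedVertex_self]
    have : σ = τ := by
      revert hpos
      cases σ <;> cases τ <;> norm_num
    rw [this]
    exact .refl _ _ (by positivity)
  | of_succ k hk ih =>
    rcases le_or_gt (1 / 4) (addressPosition a n σ (k + 1)) with h4 | h4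
    · refine (withinWalk_addressEnd_embedVertex hε a _ σ τ).mono ?_
      have h5 := hle (k + 1) k.lt_succ_self hk
      have h6 : (1 / 2 + ε) ^ (k + 1) * (1 / 4) ≤ B :=
        (mul_le_mul_of_nonneg_left h4 (by positivity)).trans h5
      calc (1 / 2 + ε) ^ k / (1 / 2 - ε)
          = 4 / ((1 / 2 - ε) * (1 / 2 + ε)) * ((1 / 2 + ε) ^ (k + 1) * (1 / 4)) := by
            rw [pow_succ]
            field_simp
        _ ≤ _ := mul_le_mul_of_nonneg_left h6 (by positivity)
    · have h5 := (addressPosition_mem a σ hk).1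
      have h6 : (a k).2 = τ := by
        rw [addressPosition_of_lt a σ hk, abs_le] at hpos
        revert hpos
        rcases (a k).2 <;> cases τ <;>
          simp only [if_true, if_false, Bool.false_eq_true, reduceCtorEq] <;>
          rintro ⟨h7, h8⟩ <;> first | trivial | linarith
      have h7 := ih false (fun j hj => hle j (k.lt_succ_self.trans hj)) (by
        rw [if_neg Bool.false_ne_true, sub_zero, abs_of_nonneg h5]
        linarith)
      rwa [addressEnd_succ_false, embedVertex_oldVertex hk, h6] at h7

theorem mul_le_norm_smul_sub_smul {X : Type*} [NormedAddCommGroup X] [NormedSpace ℝ X]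
    {x x' : X} {δ s s' : ℝ} (hx : ‖x‖ = 1) (hx' : ‖x'‖ = 1) (h : δ ≤ ‖x - x'‖)
    (hs : 0 ≤ s) (hs' : 0 ≤ s') :
    δ / 2 * s ≤ ‖s • x - s' • x'‖ ∧ δ / 2 * s' ≤ ‖s • x - s' • x'‖ := by
  have h1 : |s - s'| ≤ ‖s • x - s' • x'‖ := by
    have := abs_norm_sub_norm_le (s • x) (s' • x')
    rwa [norm_smul, norm_smul, hx, hx', mul_one, mul_one, Real.norm_of_nonneg hs,
      Real.norm_of_nonneg hs'] at this
  have h2 : s * δ ≤ ‖s • x - s' • x'‖ + |s - s'| := by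
    have h3 : s • (x - x') = (s • x - s' • x') - (s - s') • x' := by module
    have h4 : s * ‖x - x'‖ ≤ ‖s • x - s' • x'‖ + |s - s'| := by
      rw [← Real.norm_of_nonneg hs, ← norm_smul, h3, Real.norm_of_nonneg hs]
      refine (norm_sub_le _ _).trans ?_
      rw [norm_smul, hx', mul_one, Real.norm_eq_abs]
    exact (mul_le_mul_of_nonneg_left h hs).trans h4
  have h2' : s' * δ ≤ ‖s • x - s' • x'‖ + |s - s'| := by
    have h3 : s' • (x - x') = (s • x - s' • x') - (s - s') • x := by module
    have h4 : s' * ‖x - x'‖ ≤ ‖s • x - s' • x'‖ + |s - s'| := by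
      rw [← Real.norm_of_nonneg hs', ← norm_smul, h3, Real.norm_of_nonneg hs']
      refine (norm_sub_le _ _).trans ?_
      rw [norm_smul, hx, mul_one, Real.norm_eq_abs]
    exact (mul_le_mul_of_nonneg_left h hs').trans h4
  constructor <;> linarith

/-- If the components of every level of the images of two vertices are close, the vertices are
close. The addresses `a`, `a'` of the vertices agree below some level `m`, and then differ. -/
theorem withinWalk_of_forall_component_le {X : Type*} [NormedAddCommGroup X] [NormedSpace ℝ X]
    {ε : ℝ} (hε : ε ∈ Set.Ioo (0 : ℝ) (1 / 2)) {y₀ : X}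
    {y : ∀ n, (diamond n).2.edgeSet → Bool → X} {n : ℕ} {δ : ℝ} (hδ : 0 < δ) (hδ1 : δ ≤ 1)
    (hy₀ : ‖y₀‖ = 1) (hy : ∀ j < n, ∀ e i, ‖y j e i‖ = 1)
    (hsep : ∀ j < n, ∀ e i e' i', (e, i) ≠ (e', i') → δ ≤ ‖y j e i - y j e' i'‖)
    (a a' : ℕ → Bool × Bool) (σ σ' : Bool) {B : ℝ}
    (hle : ∀ j ≤ n, (1 / 2 + ε) ^ j * ‖addressPosition a n σ j • addressDirection y₀ y a j -
      addressPosition a' n σ' j • addressDirection y₀ y a' j‖ ≤ B) :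
    WithinWalk ε (addressEnd a n σ) (addressEnd a' n σ')
      (16 / ((1 / 2 - ε) * (1 / 2 + ε) * δ) * B) := by
  have ⟨h0, h1⟩ := hε
  have h2 : 0 < 1 / 2 - ε := by linarith
  have h3 : 0 < 1 / 2 + ε := by linarith
  have hB : 0 ≤ B := le_trans (by positivity) (hle 0 n.zero_le)
  have hden : (1 / 2 - ε) * (1 / 2 + ε) * δ ≤ (1 / 2 - ε) :=
    (mul_le_of_le_one_right (by positivity) hδ1).trans
      (mul_le_of_le_one_right h2.le (by linarith))
  have hconst : 16 / (1 / 2 - ε) * B ≤ 16 / ((1 / 2 - ε) * (1 / 2 + ε) * δ) * B := by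
    gcongr
  have hdir : ∀ b : ℕ → Bool × Bool, ∀ j ≤ n, ‖addressDirection y₀ y b j‖ = 1 := by
    rintro b (_ | j) hj
    · exact hy₀
    · exact hy j hj _ _
  by_cases hall : ∀ j < n, a j = a' j
  · rw [addressEnd_congr hall]
    by_cases hσ : σ = σ'
    · rw [hσ]
      exact .refl _ _ (by positivity)
    have hd : addressDirection y₀ y a n = addressDirection y₀ y a' n := by
      rcases n with _ | n
      · rfl
      · rw [addressDirection, addressDirection, hall n n.lt_succ_self,
          addressEdge_congr fun j hj => hall j (hj.trans n.lt_succ_self)]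
    have h4 := hle n le_rfl
    rw [hd, ← sub_smul, norm_smul, hdir a' n le_rfl, addressPosition_self, addressPosition_self]
      at h4
    have h5 : (1 / 2 + ε) ^ n ≤ B := by
      revert h4 hσ
      cases σ <;> cases σ' <;> simp
    refine (WithinWalk.addressEnd ε a' σ σ' h3.le).mono ((h5.trans ?_).trans hconst)
    refine le_mul_of_one_le_left hB ?_
    rw [le_div_iff₀ h2]
    linarith
  push Not at hall
  classical
  obtain ⟨hmn, hm⟩ := Nat.find_spec hall
  have hlt : ∀ j < Nat.find hall, a j = a' j := by
    intro j hj
    by_contra h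
    exact Nat.find_min hall hj ⟨hj.trans hmn, h⟩
  set m := Nat.find hall
  have hdm : addressDirection y₀ y a m = addressDirection y₀ y a' m := by
    rcases hm' : m with _ | k
    · rfl
    · rw [addressDirection, addressDirection, hlt k (by omega),
        addressEdge_congr fun j hj => hlt j (by omega)]
  -- Above level `m + 1`, the directions for `a` and `a'` differ.
  have hpos : ∀ j, m < j → j ≤ n → (j = m + 1 → (a m).1 ≠ (a' m).1) →
      (1 / 2 + ε) ^ j * addressPosition a n σ j ≤ 2 / δ * B ∧
        (1 / 2 + ε) ^ j * addressPosition a' n σ' j ≤ 2 / δ * B := by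
    intro j hmj hj hside
    obtain ⟨i, rfl⟩ : ∃ i, j = i + 1 := ⟨j - 1, by omega⟩
    have hne : (addressEdge a i, (a i).1) ≠ (addressEdge a' i, (a' i).1) := by
      intro h
      obtain ⟨h4, h5⟩ := Prod.mk_inj.1 h
      rcases eq_or_ne i m with rfl | him
      · exact hside rfl h5
      · exact hm (addressEdge_inj h4 m (by omega))
    obtain ⟨h4, h5⟩ := mul_le_norm_smul_sub_smul (hdir a _ hj) (hdir a' _ hj)
      (hsep i hj _ _ _ _ hne) (addressPosition_mem a σ hj).1 (addressPosition_mem a' σ' hj).1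
    have h6 := hle (i + 1) hj
    have h7 : 0 < (1 / 2 + ε) ^ (i + 1) := by positivity
    constructor <;> rw [div_mul_eq_mul_div, le_div_iff₀ hδ] <;>
      nlinarith [mul_le_mul_of_nonneg_left h4 h7.le, mul_le_mul_of_nonneg_left h5 h7.le]
  have hm0 := hle m hmn.le
  rw [hdm, ← sub_smul, norm_smul, hdir a' m hmn.le, mul_one, Real.norm_eq_abs] at hm0
  -- Both vertices are in the part that replaces an edge of `D m`.
  have hcoarse : WithinWalk ε (addressEnd a n σ) (addressEnd a' n σ')
      (2 / (1 / 2 - ε) * (1 / 2 + ε) ^ m) := by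
    have h4 := withinWalk_addressEnd_embedVertex hε a hmn.le σ false
    have h5 := withinWalk_addressEnd_embedVertex hε a' hmn.le σ' false
    rw [addressEnd_congr hlt] at h4
    refine (h4.trans h5.symm).mono (le_of_eq ?_)
    ring
  rcases le_or_gt (1 / 8) |addressPosition a n σ m - addressPosition a' n σ' m| with h4 | h4
  · refine hcoarse.mono (le_trans ?_ hconst)
    have h5 : (1 / 2 + ε) ^ m * (1 / 8) ≤ B :=
      (mul_le_mul_of_nonneg_left h4 (by positivity)).trans hm0
    calc 2 / (1 / 2 - ε) * (1 / 2 + ε) ^ m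
        = 16 / (1 / 2 - ε) * ((1 / 2 + ε) ^ m * (1 / 8)) := by ring
      _ ≤ _ := mul_le_mul_of_nonneg_left h5 (by positivity)
  rw [addressPosition_of_lt a σ hmn, addressPosition_of_lt a' σ' hmn, abs_lt] at h4
  obtain ⟨hp0, hp1⟩ := addressPosition_mem a σ hmn
  obtain ⟨hp0', hp1'⟩ := addressPosition_mem a' σ' hmn
  -- A common end of the edges of level `m + 1` to which both vertices are close.
  have hclose : ∀ τ : Bool, addressEnd a (m + 1) τ = addressEnd a' (m + 1) τ →
      |addressPosition a n σ (m + 1) - if τ then 1 else 0| ≤ 3 / 4 →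
      |addressPosition a' n σ' (m + 1) - if τ then 1 else 0| ≤ 3 / 4 →
      WithinWalk ε (addressEnd a n σ) (addressEnd a' n σ')
        (16 / ((1 / 2 - ε) * (1 / 2 + ε) * δ) * B) := by
    intro τ hτ h5 h6
    have h7 := withinWalk_of_forall_position_le hε a hmn σ τ (B := 2 / δ * B) (by positivity)
      (fun j hj hjn => (hpos j (m.lt_succ_self.trans hj) hjn (by omega)).1) h5
    have h8 := withinWalk_of_forall_position_le hε a' hmn σ' τ (B := 2 / δ * B) (by positivity)
      (fun j hj hjn => (hpos j (m.lt_succ_self.trans hj) hjn (by omega)).2) h6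
    rw [hτ] at h7
    refine (h7.trans h8.symm).mono (le_of_eq ?_)
    field_simp
    ring
  by_cases hside : (a m).1 = (a' m).1
  · have hend : (a m).2 ≠ (a' m).2 := fun h => hm (Prod.ext hside h)
    have h5 : 3 / 4 < addressPosition a n σ (m + 1) ∧ 3 / 4 < addressPosition a' n σ' (m + 1) := by
      revert h4 hend
      rcases (a m).2 <;> rcases (a' m).2 <;>
        simp only [if_true, if_false, Bool.false_eq_true, ne_eq, not_true, reduceCtorEq,
          not_false_eq_true, false_implies, true_implies] <;>
        rintro ⟨h4, h5⟩ <;> constructor <;> linarith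
    refine hclose true ?_ ?_ ?_
    · rw [addressEnd_succ_true, addressEnd_succ_true, hside, addressEdge_congr hlt]
    · rw [if_pos rfl, abs_le]
      constructor <;> linarith
    · rw [if_pos rfl, abs_le]
      constructor <;> linarith
  · obtain ⟨h5, h6⟩ := hpos (m + 1) m.lt_succ_self hmn fun _ => hside
    by_cases hbig : 1 / 4 ≤ addressPosition a n σ (m + 1) ∨ 1 / 4 ≤ addressPosition a' n σ' (m + 1)
    · have h7 : (1 / 2 + ε) ^ (m + 1) * (1 / 4) ≤ 2 / δ * B := by
        rcases hbig with h | h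
        · exact (mul_le_mul_of_nonneg_left h (by positivity)).trans h5
        · exact (mul_le_mul_of_nonneg_left h (by positivity)).trans h6
      refine hcoarse.mono ?_
      calc 2 / (1 / 2 - ε) * (1 / 2 + ε) ^ m
          = 8 / ((1 / 2 - ε) * (1 / 2 + ε)) * ((1 / 2 + ε) ^ (m + 1) * (1 / 4)) := by
            field_simp
            ring
        _ ≤ 8 / ((1 / 2 - ε) * (1 / 2 + ε)) * (2 / δ * B) :=
            mul_le_mul_of_nonneg_left h7 (by positivity)
        _ = _ := by
            field_simp
            ring
    · push Not at hbig
      obtain ⟨h7, h8⟩ := hbig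
      have hend : (a m).2 = (a' m).2 := by
        revert h4
        rcases (a m).2 <;> rcases (a' m).2 <;>
          simp only [if_true, if_false, Bool.false_eq_true, reduceCtorEq] <;>
          rintro ⟨h4, h5⟩ <;> first | trivial | linarith
      refine hclose false ?_ ?_ ?_
      · rw [addressEnd_succ_false, addressEnd_succ_false, hend, addressEnd_congr hlt]
      · rw [if_neg Bool.false_ne_true, sub_zero, abs_of_nonneg hp0]
        linarith
      · rw [if_neg Bool.false_ne_true, sub_zero, abs_of_nonneg hp0']
        linarith

/-! ### Separated unit vectors in a finite-dimensional space -/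

section Separated

variable {E : Type*} [NormedAddCommGroup E] [NormedSpace ℝ E]

open MeasureTheory Metric in
/-- The balls of radius `1/8` around the points of a `1/16`-net of the unit sphere cover the shell
between the radii `15/16` and `1`; the comparison of volumes bounds the size of the net below. -/
theorem exists_norm_eq_one_forall_le_norm_sub [FiniteDimensional ℝ E] [Nontrivial E]
    (S : Finset E) (hS : 16 * S.card < 8 ^ Module.finrank ℝ E) :
    ∃ x : E, ‖x‖ = 1 ∧ ∀ s ∈ S, 1 / 16 ≤ ‖x - s‖ := by
  by_contra! hcon
  borelize E
  let μ : Measure E := Measure.addHaar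
  set d := Module.finrank ℝ E
  have hd : d ≠ 0 := Module.finrank_pos.ne'
  have hcover : ball (0 : E) 1 ⊆ ball 0 (15 / 16) ∪ ⋃ s ∈ S, ball s (1 / 8) := by
    intro x hx
    rw [mem_ball_zero_iff] at hx
    rcases lt_or_ge ‖x‖ (15 / 16) with h | h
    · exact .inl (mem_ball_zero_iff.2 h)
    · right
      have hx0 : ‖x‖ ≠ 0 := by linarith
      obtain ⟨s, hs, hxs⟩ := hcon (‖x‖⁻¹ • x) (by
        rw [norm_smul, norm_inv, norm_norm, inv_mul_cancel₀ hx0])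
      refine Set.mem_iUnion₂.2 ⟨s, hs, ?_⟩
      rw [mem_ball_iff_norm]
      have h1 : ‖x - ‖x‖⁻¹ • x‖ ≤ 1 / 16 := by
        have h2 : x - ‖x‖⁻¹ • x = (1 - ‖x‖⁻¹) • x := by module
        have h3 : |1 - ‖x‖⁻¹| * ‖x‖ = |‖x‖ - 1| := by
          rw [← abs_norm x, ← abs_mul, abs_norm, sub_mul, one_mul, inv_mul_cancel₀ hx0]
        rw [h2, norm_smul, Real.norm_eq_abs, h3, abs_le]
        constructor <;> linarith
      linarith [norm_sub_le_norm_sub_add_norm_sub x (‖x‖⁻¹ • x) s]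
  have hμ : μ.real (ball (0 : E) 1) ≤
      μ.real (ball (0 : E) (15 / 16)) + ∑ s ∈ S, μ.real (ball s (1 / 8)) := by
    have hfin : μ (ball 0 (15 / 16) ∪ ⋃ s ∈ S, ball s (1 / 8)) ≠ ⊤ := by
      refine (measure_union_lt_top measure_ball_lt_top ?_).ne
      exact measure_biUnion_lt_top S.finite_toSet fun s _ => measure_ball_lt_top
    exact (measureReal_mono hcover hfin).trans ((measureReal_union_le _ _).trans
      (add_le_add le_rfl (measureReal_biUnion_finset_le _ _)))
  have hball : ∀ (x : E) (r : ℝ), 0 ≤ r → μ.real (ball x r) = r ^ d * μ.real (ball 0 1) := by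
    intro x r hr
    rw [Measure.real, Measure.addHaar_ball μ x hr, ENNReal.toReal_mul,
      ENNReal.toReal_ofReal (by positivity)]
    rfl
  rw [hball 0 (15 / 16) (by norm_num), Finset.sum_congr rfl fun s _ => hball s (1 / 8) (by norm_num),
    Finset.sum_const, nsmul_eq_mul] at hμ
  have hpos : 0 < μ.real (ball (0 : E) 1) :=
    ENNReal.toReal_pos (measure_ball_pos μ 0 one_pos).ne' measure_ball_lt_top.ne
  have h1 : (1 : ℝ) ≤ (15 / 16) ^ d + S.card * (1 / 8) ^ d := by
    refine le_of_mul_le_mul_right ?_ hpos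
    linarith
  have h2 : (15 / 16 : ℝ) ^ d ≤ 15 / 16 := pow_le_of_le_one (by norm_num) (by norm_num) hd
  have h3 : (16 * S.card : ℝ) < 8 ^ d := by exact_mod_cast hS
  have h4 : (8 : ℝ) ^ d * (1 / 8) ^ d = 1 := by rw [← mul_pow]; norm_num
  have h5 : (0 : ℝ) < (1 / 8) ^ d := by positivity
  nlinarith [mul_lt_mul_of_pos_right h3 h5]

theorem exists_separated_finset [FiniteDimensional ℝ E] [Nontrivial E] (N : ℕ)
    (hN : 16 * N ≤ 8 ^ Module.finrank ℝ E) :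
    ∃ S : Finset E, S.card = N ∧ (∀ x ∈ S, ‖x‖ = 1) ∧
      ∀ x ∈ S, ∀ x' ∈ S, x ≠ x' → 1 / 16 ≤ ‖x - x'‖ := by
  classical
  induction N with
  | zero => exact ⟨∅, by simp⟩
  | succ N ih =>
    obtain ⟨S, hcard, hS1, hS⟩ := ih (by omega)
    obtain ⟨x, hx, hxS⟩ := exists_norm_eq_one_forall_le_norm_sub S (by omega)
    have hxnot : x ∉ S := by
      intro h
      have := hxS x h
      norm_num at this
    refine ⟨insert x S, by rw [Finset.card_insert_of_notMem hxnot, hcard], ?_, ?_⟩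
    · simpa [hx] using hS1
    · intro u hu v hv huv
      rw [Finset.mem_insert] at hu hv
      rcases hu with rfl | hu <;> rcases hv with rfl | hv
      · exact (huv rfl).elim
      · exact hxS v hv
      · rw [norm_sub_rev]
        exact hxS u hu
      · exact hS u hu v hv huv

theorem exists_separated_family {ι : Type*} [Finite ι] (F : Submodule ℝ E) {d : ℕ} (hd : d ≠ 0)
    (hF : Module.finrank ℝ F = d) (hι : 16 * Nat.card ι ≤ 8 ^ d) :
    ∃ y : ι → E, (∀ i, y i ∈ F ∧ ‖y i‖ = 1) ∧ ∀ i j, i ≠ j → 1 / 16 ≤ ‖y i - y j‖ := by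
  have : FiniteDimensional ℝ F := Module.finite_of_finrank_pos (by omega)
  have : Nontrivial F := Module.nontrivial_of_finrank_pos (R := ℝ) (by omega)
  obtain ⟨S, hcard, hS1, hS⟩ := exists_separated_finset (E := F) (Nat.card ι) (by rwa [hF])
  have := Fintype.ofFinite ι
  have e : ι ≃ S := Fintype.equivOfCardEq (by
    rw [Fintype.card_coe, hcard, Nat.card_eq_fintype_card])
  refine ⟨fun i => ((e i : F) : E), fun i => ⟨(e i : F).2, hS1 _ (e i).2⟩, fun i j hij => ?_⟩
  exact hS _ (e i).2 _ (e j).2 fun h => hij (e.injective (Subtype.ext h))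

end Separated

/-! ### Blocks of a basis -/

/-- The first `N` vectors of a basis, and the projections onto the spans of its initial segments. -/
theorem HasSchauderBasisLE.exists_projections {𝕜 X : Type*} [RCLike 𝕜] [NormedAddCommGroup X]
    [NormedSpace 𝕜 X] {C : ℝ} (hC : 0 ≤ C) (h : HasSchauderBasisLE 𝕜 X C) {N : ℕ}
    (hN : (N : Cardinal) ≤ Module.rank 𝕜 X) :
    ∃ (v : ℕ → X) (P : ℕ → X →L[𝕜] X), (∀ j ≤ N, ‖P j‖ ≤ C) ∧
      (∀ j, ∀ i < N, P j (v i) = if i < j then v i else 0) ∧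
      LinearIndependent 𝕜 fun i : Fin N => v i := by
  have hnorm : ∀ T : X →L[𝕜] X, ‖T‖ₑ ≤ ENNReal.ofReal C → ‖T‖ ≤ C := fun T hT => by
    rwa [← ofReal_norm, ENNReal.ofReal_le_ofReal_iff hC] at hT
  rcases h with ⟨d, b, hb⟩ | ⟨b, hb⟩
  · have hspan : Submodule.span 𝕜 (Set.range b) = ⊤ := by
      refine eq_top_iff.2 fun x _ => ?_
      have h1 : x = ∑ i, b.coord i x • b i := (b.expansion x).unique (hasSum_fintype _)
      rw [h1]
      exact Submodule.sum_mem _ fun i _ =>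
        Submodule.smul_mem _ _ (Submodule.subset_span ⟨i, rfl⟩)
    have hNd : N ≤ d := by
      have h1 := rank_span_le (R := 𝕜) (Set.range b)
      rw [hspan, rank_top] at h1
      have h2 := Cardinal.lift_le.{0}.2 (hN.trans h1) |>.trans Cardinal.mk_range_le_lift
      rw [Cardinal.mk_fin] at h2
      simpa using h2
    refine ⟨fun i => if h : i < d then b ⟨i, h⟩ else 0,
      fun j => b.proj (Finset.univ.filter fun i => i.val < j), fun j hj => ?_, fun j i hi => ?_, ?_⟩
    · rcases j with _ | j
      · simpa using hC
      · have h1 : (Finset.univ.filter fun i : Fin d => i.val < j + 1) =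
            Finset.Iic ⟨j, by omega⟩ := by
          ext i
          simp [Fin.le_def]
        beta_reduce
        rw [h1]
        exact hnorm _ ((le_iSup (fun j => ‖b.proj (Finset.Iic j)‖ₑ) _).trans hb)
    · simp only [dif_pos (hi.trans_le hNd)]
      rw [b.proj_apply_basis_mem]
      simp
    · have h1 : (fun i : Fin N => if h : i.val < d then b ⟨i, h⟩ else 0) =
          b ∘ Fin.castLE hNd := by
        funext i
        exact dif_pos (i.2.trans_le hNd)
      change LinearIndependent 𝕜 (fun i : Fin N => if h : i.val < d then b ⟨i, h⟩ else 0)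
      rw [h1]
      exact b.linearIndependent.comp _ (Fin.castLE_injective hNd)
  · refine ⟨b, fun j => GeneralSchauderBasis.proj b (Finset.range j), fun j _ => ?_,
      fun j i _ => ?_, b.linearIndependent.comp _ Fin.val_injective⟩
    · rcases j with _ | j
      · simpa using hC
      · beta_reduce
        rw [Nat.range_succ_eq_Iic]
        exact hnorm _ ((le_iSup (fun j => ‖GeneralSchauderBasis.proj b (Finset.Iic j)‖ₑ) j).trans hb)
    · rw [GeneralSchauderBasis.proj_apply_basis_mem]
      simp

/-- The index at which the `k`-th block of the basis starts; the blocks have sizes `1, 2, 3, …`. -/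
def blockStart (k : ℕ) : ℕ := ∑ i ∈ Finset.range k, (i + 1)

theorem blockStart_succ (k : ℕ) : blockStart (k + 1) = blockStart k + (k + 1) :=
  Finset.sum_range_succ _ _

theorem two_mul_blockStart (k : ℕ) : 2 * blockStart k = k * (k + 1) := by
  induction k with
  | zero => rfl
  | succ k ih =>
    rw [blockStart_succ, mul_add, ih]
    ring

theorem blockStart_mono : Monotone blockStart :=
  monotone_nat_of_le_succ fun k => by rw [blockStart_succ]; omega

/-- The real span of the `k`-th block of the sequence `v`. -/
def blockSpan {X : Type*} [NormedAddCommGroup X] [NormedSpace ℝ X] (v : ℕ → X) (k : ℕ) :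
    Submodule ℝ X :=
  Submodule.span ℝ (Set.range fun i : Fin (k + 1) => v (blockStart k + i))

/-- Images of vertices are told apart level by level: the difference of two projections isolates the
component of one level, up to the factor `2 * C`. -/
theorem dEmbeds_weightedDiamond {X : Type*} [NormedAddCommGroup X] [NormedSpace ℝ X]
    {ε : ℝ} (hε : ε ∈ Set.Ioo (0 : ℝ) (1 / 2)) {C : ℝ} (hC : 0 ≤ C) (n : ℕ) {v : ℕ → X}
    {P : ℕ → X →L[ℝ] X} (hP : ∀ j ≤ blockStart (n + 1), ‖P j‖ ≤ C)
    (hPv : ∀ j, ∀ i < blockStart (n + 1), P j (v i) = if i < j then v i else 0)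
    (hv : LinearIndependent ℝ fun i : Fin (blockStart (n + 1)) => v i) :
    DEmbeds ((1 / 2 + ε) / ε * (16 / ((1 / 2 - ε) * (1 / 2 + ε) * (1 / 16)) * (2 * C)))
      (weightedDiamondDist ε n) X := by
  have ⟨hε0, hε1⟩ := hε
  have hε2 : 0 < 1 / 2 - ε := by linarith
  have hlt : ∀ k ≤ n, ∀ i : Fin (k + 1), blockStart k + i < blockStart (n + 1) := by
    intro k hk i
    have h1 := blockStart_mono (add_le_add_left hk 1)
    rw [blockStart_succ k] at h1
    omega
  have hfinrank : ∀ k ≤ n, Module.finrank ℝ (blockSpan v k) = k + 1 := by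
    intro k hk
    have h1 : LinearIndependent ℝ fun i : Fin (k + 1) => v (blockStart k + i) :=
      hv.comp (fun i : Fin (k + 1) => ⟨blockStart k + i, hlt k hk i⟩) fun i j hij => by
        simpa [Fin.ext_iff] using hij
    rw [blockSpan, finrank_span_eq_card h1, Fintype.card_fin]
  have hQ : ∀ k ≤ n, ∀ j ≤ n, ∀ x ∈ blockSpan v j,
      (P (blockStart (k + 1)) - P (blockStart k)) x = if j = k then x else 0 := by
    intro k hk j hj x hx
    have hgen : ∀ i : Fin (j + 1), (P (blockStart (k + 1)) - P (blockStart k))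
        (v (blockStart j + i)) = if j = k then v (blockStart j + i) else 0 := by
      intro i
      have hi := i.2
      rw [_root_.sub_apply, hPv _ _ (hlt j hj i), hPv _ _ (hlt j hj i)]
      rcases lt_trichotomy j k with h | rfl | h
      · have h1 := blockStart_mono (Nat.succ_le_of_lt h)
        have h2 := blockStart_succ k
        rw [Nat.succ_eq_add_one, blockStart_succ] at h1
        rw [if_pos (by omega), if_pos (by omega), if_neg h.ne, sub_self]
      · rw [if_pos (by rw [blockStart_succ]; omega), if_neg (by omega), if_pos rfl, sub_zero]
      · have h1 := blockStart_mono (Nat.succ_le_of_lt h)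
        have h2 := blockStart_succ k
        rw [Nat.succ_eq_add_one] at h1
        rw [if_neg (by omega), if_neg (by omega), if_neg h.ne', sub_self]
    induction hx using Submodule.span_induction with
    | mem x hx =>
      obtain ⟨i, rfl⟩ := hx
      exact hgen i
    | zero => simp
    | add x z _ _ hx hz =>
      rw [map_add, hx, hz]
      split_ifs <;> simp
    | smul c x _ hx =>
      rw [map_smul, hx]
      split_ifs <;> simp
  obtain ⟨y₀, hy₀⟩ : ∃ y₀ : blockSpan v 0, ‖y₀‖ = 1 := by
    have : Nontrivial (blockSpan v 0) :=
      Module.nontrivial_of_finrank_pos (R := ℝ) (by rw [hfinrank 0 n.zero_le]; exact one_pos)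
    exact exists_norm_eq _ zero_le_one
  have hex : ∀ j, ∃ z : (diamond j).2.edgeSet × Bool → X, j < n →
      (∀ p, z p ∈ blockSpan v (j + 1) ∧ ‖z p‖ = 1) ∧
        ∀ p q, p ≠ q → 1 / 16 ≤ ‖z p - z q‖ := by
    intro j
    by_cases hj : j < n
    · obtain ⟨z, hz⟩ := exists_separated_family (ι := (diamond j).2.edgeSet × Bool)
        (blockSpan v (j + 1)) (Nat.succ_ne_zero _) (hfinrank (j + 1) hj) (by
          rw [Nat.succ_eq_add_one, Nat.card_prod, (card_diamond_edgeSet j).2, Nat.card_eq_fintype_card,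
            Fintype.card_bool]
          have h1 : 4 ^ j ≤ 8 ^ j := Nat.pow_le_pow_left (by norm_num) j
          rw [pow_succ, pow_succ]
          omega)
      exact ⟨z, fun _ => hz⟩
    · exact ⟨0, fun h => (hj h).elim⟩
  choose z hz using hex
  let y : ∀ j, (diamond j).2.edgeSet → Bool → X := fun j e i => z j (e, i)
  have hy : ∀ j < n, ∀ e i, ‖y j e i‖ = 1 := fun j hj e i => ((hz j hj).1 (e, i)).2
  set f := diamondMap ε (y₀ : X) y n
  have hmem : ∀ a : ℕ → Bool × Bool, ∀ j ≤ n, addressDirection (y₀ : X) y a j ∈ blockSpan v j := by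
    rintro a (_ | j) hj
    · exact y₀.2
    · exact ((hz j hj).1 _).1
  have hQf : ∀ k ≤ n, ∀ a σ, (P (blockStart (k + 1)) - P (blockStart k)) (f (addressEnd a n σ)) =
      ((1 / 2 + ε) ^ k * addressPosition a n σ k) • addressDirection (y₀ : X) y a k := by
    intro k hk a σ
    rw [show f = diamondMap ε (y₀ : X) y n from rfl, diamondMap_addressEnd, map_sum, Finset.sum_eq_single k]
    · rw [map_smul, hQ k hk k hk _ (hmem a k hk), if_pos rfl]
    · intro j hj hjk
      have hj' : j ≤ n := Nat.lt_succ_iff.1 (Finset.mem_range.1 hj)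
      rw [map_smul, hQ k hk j hj' _ (hmem a j hj'), if_neg hjk, smul_zero]
    · exact fun h => (h (Finset.mem_range.2 (Nat.lt_succ_of_le hk))).elim
  have hlower : ∀ x x' : DiamondVertex n,
      WithinWalk ε x x' (16 / ((1 / 2 - ε) * (1 / 2 + ε) * (1 / 16)) * (2 * C * ‖f x - f x'‖)) := by
    intro x x'
    obtain ⟨a, σ, rfl⟩ := exists_addressEnd_eq x
    obtain ⟨a', σ', rfl⟩ := exists_addressEnd_eq x'
    refine withinWalk_of_forall_component_le hε (by norm_num) (by norm_num) (y₀ := (y₀ : X))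
      (y := y) hy₀ hy (fun j hj e i e' i' hne => (hz j hj).2 _ _ hne) a a' σ σ' fun k hk => ?_
    have h1 : 0 < (1 / 2 + ε) ^ k := by positivity
    rw [← Real.norm_of_nonneg h1.le, ← norm_smul, smul_sub, smul_smul, smul_smul, ← hQf k hk,
      ← hQf k hk, ← map_sub]
    refine (ContinuousLinearMap.le_opNorm _ _).trans ?_
    gcongr
    refine (norm_sub_le _ _).trans ?_
    have h2 := hP _ (blockStart_mono (add_le_add_left hk 1))
    have h3 := hP _ (blockStart_mono (hk.trans n.le_succ))
    linarith
  have hupper := norm_sub_le_mul_weightedDiamondDist (f := f) (ε := ε)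
    (show 0 < (1 / 2 + ε) / ε by positivity) fun u v huv =>
      norm_diamondMap_sub_le_of_adj (y := y) hε hy₀.le (fun j hj e i => (hy j hj e i).le) huv
  refine ⟨f, fun x x' hxx' => ?_, ?_⟩
  · by_contra hne
    have h1 := hlower x x'
    rw [hxx', sub_self, norm_zero, mul_zero, mul_zero] at h1
    exact not_withinWalk_zero hε hne h1
  · rw [distortion, ENNReal.ofReal_mul (by positivity)]
    refine mul_le_mul' (iSup_le fun x => iSup_le fun x' => iSup_le fun _ => ?_)
      (iSup_le fun x => iSup_le fun x' => iSup_le fun _ => ?_) <;>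
      refine ENNReal.ofReal_le_ofReal ?_
    · exact div_le_of_le_mul₀ (weightedDiamondDist_nonneg hε x x') (by positivity) (hupper x x')
    · refine div_le_of_le_mul₀ (norm_nonneg _) (by positivity) ?_
      rw [mul_assoc]
      exact weightedDiamondDist_le_of_withinWalk hε (hlower x x')

/-! ### Counting dimensions -/

/-- Since `2/3 > 2 ^ (-3/5)`, the logarithm of the number of vertices exceeds `2 * n - 3/5`. -/
theorem sub_le_logb_card_diamondVertex (n : ℕ) :
    2 * (n : ℝ) - 3 / 5 ≤ Real.logb 2 (Nat.card (DiamondVertex n)) := by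
  have h1 : 2 * 4 ^ n ≤ 3 * Nat.card (DiamondVertex n) := by
    rw [(three_mul_card_diamondVertex n).2]
    omega
  have h2 : (2 / 3 : ℝ) * 4 ^ n ≤ Nat.card (DiamondVertex n) := by
    have : (2 * 4 ^ n : ℝ) ≤ 3 * Nat.card (DiamondVertex n) := by exact_mod_cast h1
    linarith
  have h3 : Real.logb 2 ((2 / 3 : ℝ) * 4 ^ n) ≤ Real.logb 2 (Nat.card (DiamondVertex n)) :=
    Real.logb_le_logb_of_le (by norm_num) (by positivity) h2
  have h4 : Real.logb 2 (4 ^ n) = 2 * n := by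
    rw [show (4 : ℝ) ^ n = 2 ^ (2 * n) by rw [pow_mul]; norm_num, Real.logb_pow, Real.logb_self_eq_one
      (by norm_num)]
    push_cast
    ring
  have h5 : -3 / 5 ≤ Real.logb 2 (2 / 3) := by
    have h6 : Real.logb 2 ((2 ^ 3)⁻¹) ≤ Real.logb 2 ((2 / 3) ^ 5) :=
      Real.logb_le_logb_of_le (by norm_num) (by norm_num) (by norm_num)
    rw [Real.logb_inv, Real.logb_pow, Real.logb_pow, Real.logb_self_eq_one (by norm_num)] at h6
    push_cast at h6
    linarith
  rw [Real.logb_mul (by norm_num) (by positivity), h4] at h3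
  linarith

theorem blockStart_le_ceil {n : ℕ} (hn : 2 ≤ n) :
    blockStart (n + 1) ≤ ⌈(1 / 2 : ℝ) * (Real.logb 2 (Nat.card (DiamondVertex n))) ^ 2⌉₊ := by
  have h1 := sub_le_logb_card_diamondVertex n
  have h2 : (2 : ℝ) ≤ n := by exact_mod_cast hn
  have h3 : (2 * (n : ℝ) - 3 / 5) ^ 2 ≤ (Real.logb 2 (Nat.card (DiamondVertex n))) ^ 2 :=
    pow_le_pow_left₀ (by linarith) h1 2
  have h4 : (2 * blockStart (n + 1) : ℝ) = (n + 1) * (n + 2) := by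
    exact_mod_cast two_mul_blockStart (n + 1)
  -- For `n = 2` the bound on the logarithm does not reach the integer before rounding up.
  refine Nat.le_of_pred_lt (Nat.lt_ceil.2 ?_)
  have h5 : 1 ≤ blockStart (n + 1) := by rw [blockStart_succ]; omega
  rw [Nat.pred_eq_sub_one, Nat.cast_sub h5, Nat.cast_one]
  nlinarith

theorem theorem3p10 (C : ℝ) (hC : 1 ≤ C) (ε : ℝ) (hε : ε ∈ Set.Ioo (0 : ℝ) (1 / 2)) :
    ∃ D : ℝ, 1 ≤ D ∧ ∀ n : ℕ, 2 ≤ n →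
      ∀ (𝕜 : Type*) [RCLike 𝕜] (X : Type*) [NormedAddCommGroup X] [NormedSpace 𝕜 X]
        [CompleteSpace X],
        HasSchauderBasisLE 𝕜 X C →
        ((⌈(1 / 2 : ℝ) * (Real.logb 2 (Nat.card (DiamondVertex n))) ^ 2⌉₊ : ℕ) : Cardinal) ≤
          Module.rank 𝕜 X →
        DEmbeds D (weightedDiamondDist ε n) X := by
  have ⟨hε0, hε1⟩ := hε
  have hε2 : 0 < 1 / 2 - ε := by linarith
  have hL : 1 ≤ (1 / 2 + ε) / ε := by
    rw [le_div_iff₀ hε0]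
    linarith
  have hK : 1 ≤ 16 / ((1 / 2 - ε) * (1 / 2 + ε) * (1 / 16)) := by
    rw [le_div_iff₀ (by positivity)]
    nlinarith
  refine ⟨(1 / 2 + ε) / ε * (16 / ((1 / 2 - ε) * (1 / 2 + ε) * (1 / 16)) * (2 * C)),
    one_le_mul_of_one_le_of_one_le hL (one_le_mul_of_one_le_of_one_le hK (by linarith)), ?_⟩
  intro n hn 𝕜 _ X _ _ _ hX hrank
  have hN : (blockStart (n + 1) : Cardinal) ≤ Module.rank 𝕜 X :=
    (Nat.cast_le.2 (blockStart_le_ceil hn)).trans hrank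
  obtain ⟨v, P, hP, hPv, hv⟩ := hX.exists_projections (by linarith) hN
  let _ : NormedSpace ℝ X := NormedSpace.restrictScalars ℝ 𝕜 X
  have : IsScalarTower ℝ 𝕜 X := RestrictScalars.isScalarTower ℝ 𝕜 X
  exact dEmbeds_weightedDiamond hε (by linarith) n (P := fun j => (P j).restrictScalars ℝ)
    (fun j hj => by rw [ContinuousLinearMap.norm_restrictScalars]; exact hP j hj)
    (fun j i hi => hPv j i hi)
    (hv.restrict_scalars fun r s h => by simpa using h)
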